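/- **Logs, stake.** Fix sets of identifiers and of ordinary transactions. A transaction is either ordinary or an epoch-ending transaction $(\textsc{finish},e)$ issued by an identifier $\mathit{id}$. A log is a finite sequence of transactions; $L'$ extends $L$ if $L$ is a prefix of $L'$; two logs are consistent if one extends the other. A stake function $\mathsf S$ gives every log $L$ finitely many identifiers with stake $\mathsf S(L,\mathit{id})>0$, with the same total $\mathbb T>0$ for all $L$. Fix $0\le\rho<1/2$, integers $\Delta\ge 1$ and $\ell\ge 0$. **Epochs.** Relative to a genesis log $L_g$, a log $L$ that extends $L_g$ has an epoch, and may be completed. $L_g$ has epoch $0$ and is completed. For $L\ne L_g$ let $L^-$ be $L$ without its last transaction. If $L^-$ is completed, then $L$ has epoch $\mathrm{epoch}(L^-)+1$ and $\mathrm{base}(L)=L^-$; otherwise it has the epoch and the base of $L^-$. The validators of $L$ are the identifiers with positive stake under $\mathrm{base}(L)$. $L$ can complete if the validators $\mathit{id}$ whose transaction $(\textsc{finish},\mathrm{epoch}(L))$ is in $L$ have total stake $>\rho\mathbb T$ under $\mathrm{base}(L)$. $L$ is completed if it can complete and no strictly shorter prefix of $L$ of the same epoch can. $L$ is certified by a set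 of signatures if validators of $L$ with total stake $\ge(1-\rho)\mathbb T$ under $\mathrm{base}(L)$ have signed $L$ ($L_g$ always is certified), and fully-certified if $L$ and all its completed prefixes of smaller epoch are certified. **Protocols, executions.** A protocol gives every node, for every genesis log $L_g$, an initial state and a deterministic transition that, in one timeslot, maps the state and the sets of received messages and of received transactions to a new state and a set of disseminated messages. Each state has a log; the log of the initial state is $L_g$. Messages contain idealized signatures of nodes. In an execution, an adversary controls a set of faulty nodes that is fixed at the start, the transactions that are input, and the network, with these limits: a message received by a correct node contains a signature of a correct node only if a correct node sent that signature in an earlier timeslot; correct nodes may be waiting (idle) only before an unknown timeslot $\mathrm{GST}$; a message sent by a correct node at $t'$ is received by every correct node that is active at a timeslot $t\ge\max(\mathrm{GST},t')+\Delta$ by timeslot $t$. Let $\mathsf{logs}(\mathcal E)$ be the set of all logs that extend $L_g$ and are prefixes of the log of some correct node at some timeslot of $\mathcal E$. In the *permissioned* setting the nodes are the identifiers; exactly those with positive stake under $L_g$ are active, always, and the adversary is $\rho$-bounded if faulty identifiers have at most $\rho\mathbb T$ of the stake under $L_g$. In the *quasi-permissionless* setting each identifier belongs to a node; a correct node owning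 an identifier with positive stake under the log of an active correct node is active at that time, and the adversary is $\rho$-bounded if identifiers of faulty nodes have at most $\rho\mathbb T$ of the stake under each log in $\mathsf{logs}(\mathcal E)$. **Properties.** A log-specific property is a predicate $Q$ on sets of logs. It is a *safety* property if it is inherited by subsets and every set of logs without $Q$ has a finite subset without $Q$. It is *composable* if for every log $L$, every set $A$ of prefixes of $L$ and every set $B$ of pairwise consistent strict extensions of $L$: if all subsets of $A$ and all subsets of $B$ have $Q$, then all subsets of $A\cup B$ have $Q$. A protocol *satisfies* $Q$ (in a setting) if $Q(\mathsf{logs}(\mathcal E))$ holds for every genesis log $L_g$ with $Q(\{L_g\})$ and every execution $\mathcal E$ from $L_g$. It is *consistent* if, from every genesis log, in every execution no correct node ever replaces its log by one that does not extend it, and the logs of any two correct nodes at the same timeslot are consistent. **Transformation.** Given a permissioned protocol $\mathcal P$, a node of $\mathcal T(\mathcal P)$ with genesis log $L_g$ keeps a log, initially $L_g$. The *run* it takes part in is that of $\mathcal P$ with genesis log $B$, where $B$ is its log if that is completed and the base of its log otherwise. In each timeslot it (1) adopts a fully-certified strict extension of its log, if it has received the signatures for one (any fixed rule may choose among several), and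 gossips the signatures received on prefixes of the new log; (2) if this changes $B$, quits its run and starts the new one, with the messages for it and all transactions received so far; (3) executes, for each of its identifiers with positive stake under $B$, one timeslot of $\mathcal P$ in that run, with all messages and their signatures bound to $B$, and signs every newly obtained prefix of the resulting log that strictly extends $B$ and has epoch $\mathrm{epoch}(B)+1$; (4) gossips new transactions and, after $\ell+\Delta$ timeslots in the run, issues $(\textsc{finish},\mathrm{epoch}(B)+1)$ for each of these identifiers. **Theorem.** Let $\mathcal P$ be a permissioned protocol that is consistent against $\rho$-bounded static adversaries, and let $Q$ be a composable log-specific safety property that $\mathcal P$ satisfies in the permissioned setting against $\rho$-bounded static adversaries. Then $\mathcal T(\mathcal P)$ satisfies $Q$ in the quasi-permissionless setting against $\rho$-bounded static adversaries, for every assignment of identifiers to nodes. -/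

import Mathlib

open scoped NNReal

/-! ### Logs, stake, epochs -/

/-- Transactions: ordinary ones, and the epoch-ending transaction `(FINISH, e)` issued by `id`. -/
inductive Tx (Id App : Type*) where
  | app (a : App)
  | finish (id : Id) (e : ℕ)

/-- A log is a finite sequence of transactions; `L <+: L'` says that `L'` extends `L`. -/
abbrev Log (Id App : Type*) := List (Tx Id App)

/-- Two logs are consistent if one of them extends the other. -/
def LogConsistent {T : Type*} (L L' : List T) : Prop := L <+: L' ∨ L' <+: L

/-- A stake function: every log distributes the same positive total among finitely many
identifiers. -/
structure Stake (Id App : Type*) where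
  S : Log Id App → Id →₀ ℝ≥0
  total : ℝ≥0
  total_pos : 0 < total
  sum_eq : ∀ L, ((S L).sum fun _ s => s) = total

namespace Stake

variable {Id App : Type*} (σ : Stake Id App)

/-- The identifiers with positive stake under `L`. -/
def currentIds (L : Log Id App) : Set Id := {id | 0 < σ.S L id}

open Classical in
/-- The stake that the identifiers of a set `A` hold together under `L`. -/
noncomputable def weight (L : Log Id App) (A : Set Id) : ℝ :=
  ∑ id ∈ (σ.S L).support with id ∈ A, (σ.S L id : ℝ)

end Stake

/-- What is known about a log `log` that extends the genesis log:
its epoch; its prefix `base` that completed the previous epoch (its `ep_prefix (epoch - 1)`);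
whether it can complete its epoch (`canComplete`); and whether already a strictly shorter log of
the same epoch can complete (`earlier`). -/
structure EpochInfo (Id App : Type*) where
  log : Log Id App
  epoch : ℕ
  base : Log Id App
  canComplete : Prop
  earlier : Prop

namespace EpochInfo

variable {Id App : Type*}

def completed (i : EpochInfo Id App) : Prop := i.canComplete ∧ ¬ i.earlier

/-- The finishers of `L` (in epoch `e`, with validators the identifiers that hold stake in `base`)
hold more than a `ρ` fraction of the stake in `base`. -/
def canFinish (σ : Stake Id App) (ρ : ℝ) (base L : Log Id App) (e : ℕ) : Prop :=
  ρ * σ.total < σ.weight base {id | id ∈ σ.currentIds base ∧ Tx.finish id e ∈ L}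

open Classical in
/-- Append one transaction: a new epoch begins exactly if the predecessor is completed. -/
noncomputable def next (σ : Stake Id App) (ρ : ℝ) (i : EpochInfo Id App) (x : Tx Id App) :
    EpochInfo Id App :=
  if i.completed then
    { log := i.log ++ [x]
      epoch := i.epoch + 1
      base := i.log
      canComplete := canFinish σ ρ i.log (i.log ++ [x]) (i.epoch + 1)
      earlier := False }
  else
    { log := i.log ++ [x]
      epoch := i.epoch
      base := i.base
      canComplete := canFinish σ ρ i.base (i.log ++ [x]) i.epoch
      earlier := i.earlier ∨ i.canComplete }

end EpochInfo

section Epochs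

variable {Id App : Type*} (σ : Stake Id App) (ρ : ℝ) (g : Log Id App)

/-- The epoch information of a log `L` that extends the genesis log `g`
(only ever used for such logs). The genesis log has epoch `0` and is completed. -/
noncomputable def epochInfo (L : Log Id App) : EpochInfo Id App :=
  (L.drop g.length).foldl (EpochInfo.next σ ρ)
    { log := g, epoch := 0, base := g, canComplete := True, earlier := False }

noncomputable def epoch (L : Log Id App) : ℕ := (epochInfo σ ρ g L).epoch

def completed (L : Log Id App) : Prop := (epochInfo σ ρ g L).completed

/-- For `L ≠ g`: the completed log that ended the epoch before that of `L`. The validators of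
`L` are the identifiers with positive stake in it. -/
noncomputable def baseLog (L : Log Id App) : Log Id App := (epochInfo σ ρ g L).base

open Classical in
/-- The genesis log of the run of the permissioned protocol that a holder of `L` takes part in:
`L` itself if `L` is completed, and otherwise the log that completed the previous epoch. -/
noncomputable def simBase (L : Log Id App) : Log Id App :=
  if completed σ ρ g L then L else baseLog σ ρ g L

/-- `L` is certified by a set of signatures on logs: `L` is the genesis log, or validators of `L`
with at least a `1 - ρ` fraction of the stake signed it. -/
def Certified (votes : Set (Id × Log Id App)) (L : Log Id App) : Prop :=
  L = g ∨ (g <+: L ∧ (1 - ρ) * σ.total ≤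
    σ.weight (baseLog σ ρ g L) {id | id ∈ σ.currentIds (baseLog σ ρ g L) ∧ (id, L) ∈ votes})

/-- `L` and all its prefixes that completed an earlier epoch are certified. -/
def FullyCertified (votes : Set (Id × Log Id App)) (L : Log Id App) : Prop :=
  Certified σ ρ g votes L ∧
    ∀ L', g <+: L' → L' <+: L → completed σ ρ g L' → epoch σ ρ g L' < epoch σ ρ g L →
      Certified σ ρ g votes L'

end Epochs

/-! ### Protocols and executions -/

/-- A blockchain protocol, run by nodes from a given genesis log. In one timeslot a node reads
a set of messages and a set of transactions, changes its state and disseminates messages.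
A message contains a set of (idealized) signatures, each made in the name of a node. -/
structure Protocol.{u, v, w, x, y} (Node : Type u) (T : Type v) where
  State : Type w
  Msg : Type x
  Sig : Type y
  init : List T → Node → State
  step : List T → Node → State → Set Msg → Set T → State × Set Msg
  log : State → List T
  sigs : Msg → Set Sig
  signer : Sig → Node
  log_init : ∀ g p, log (init g p) = g

/-- An execution of a protocol from the genesis log `g` in the partially synchronous model with
delay bound `Δ` against a static adversary, that is, with a set `faulty` that is fixed at the
start. The adversary controls the faulty nodes, the network and the transactions. -/
structure Execution {Node T : Type*} (M : Protocol Node T) (Δ : ℕ) (g : List T) where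
  faulty : Set Node
  GST : ℕ
  active : Node → ℕ → Prop
  waiting : Node → ℕ → Prop
  state : Node → ℕ → M.State
  received : Node → ℕ → Set M.Msg
  txs : Node → ℕ → Set T
  sent : Node → ℕ → Set M.Msg
  /-- Only before the global stabilization time may a correct node be waiting. -/
  waiting_lt : ∀ p ∉ faulty, ∀ t, waiting p t → t < GST
  state_zero : ∀ p ∉ faulty, state p 0 = M.init g p
  run : ∀ p ∉ faulty, ∀ t, active p t → ¬ waiting p t →
    (state p (t + 1), sent p t) = M.step g p (state p t) (received p t) (txs p t)
  idle : ∀ p ∉ faulty, ∀ t, (¬ active p t ∨ waiting p t) →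
    state p (t + 1) = state p t ∧ sent p t = ∅ ∧ received p t = ∅
  /-- The adversary can deliver any message, at any time and any number of times, except that
  it cannot forge: a signature of a correct node must have been sent by a correct node before. -/
  unforgeable : ∀ p ∉ faulty, ∀ t, ∀ m ∈ received p t, ∀ s ∈ M.sigs m, M.signer s ∉ faulty →
    ∃ q ∉ faulty, ∃ t' < t, ∃ m' ∈ sent q t', s ∈ M.sigs m'
  /-- A message sent by a correct node at `t'` has reached every correct node that is active at
  a timeslot `t ≥ max GST t' + Δ`. -/
  delivery : ∀ p ∉ faulty, ∀ q ∉ faulty, ∀ t' t, ∀ m ∈ sent q t', max GST t' + Δ ≤ t →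
    active p t → ∃ t'' ≤ t, t' < t'' ∧ m ∈ received p t''

namespace Execution

variable {Node T : Type*} {M : Protocol Node T} {Δ : ℕ} {g : List T} (E : Execution M Δ g)

/-- The log of node `p` at timeslot `t`. -/
def log (p : Node) (t : ℕ) : List T := M.log (E.state p t)

/-- The logs that correct nodes hold at some time, together with the prefixes of these logs
(which, too, are logs that extend the genesis log). -/
def logs : Set (List T) := {L | g <+: L ∧ ∃ p ∉ E.faulty, ∃ t, L <+: E.log p t}

/-- No correct node ever rolls back its log, and logs of correct nodes never diverge. -/
def Consistent : Prop :=
  (∀ p ∉ E.faulty, ∀ t t', t ≤ t' → E.log p t <+: E.log p t') ∧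
    ∀ p ∉ E.faulty, ∀ q ∉ E.faulty, ∀ t, LogConsistent (E.log p t) (E.log q t)

end Execution

/-- The permissioned setting with a `ρ`-bounded adversary. The nodes are the identifiers; those
with positive stake in the genesis log, and no others, take part at all times, and the faulty ones
hold at most a `ρ` fraction of the stake. -/
def Permissioned {Id App : Type*} (σ : Stake Id App) (ρ : ℝ) {M : Protocol Id (Tx Id App)} {Δ : ℕ}
    {g : Log Id App} (E : Execution M Δ g) : Prop :=
  (∀ id t, E.active id t ↔ id ∈ σ.currentIds g) ∧ σ.weight g E.faulty ≤ ρ * σ.total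

/-- The quasi-permissionless setting with a `ρ`-bounded adversary, where `owner id` is the node
that the identifier `id` belongs to. Correct nodes whose identifiers have stake, by the log of some
active correct node, are active; in every log that a correct node holds, and in all prefixes of
it, the faulty nodes have at most a `ρ` fraction of the stake. -/
def QuasiPermissionless {Id App Node : Type*} (σ : Stake Id App) (ρ : ℝ) (owner : Id → Node)
    {M : Protocol Node (Tx Id App)} {Δ : ℕ} {g : Log Id App} (E : Execution M Δ g) : Prop :=
  (∀ p ∉ E.faulty, ∀ t, E.active p t →
    ∀ id ∈ σ.currentIds (E.log p t), owner id ∉ E.faulty → E.active (owner id) t) ∧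
  ∀ p ∉ E.faulty, ∀ t, ∀ L, g <+: L → L <+: E.log p t →
    σ.weight L {id | owner id ∈ E.faulty} ≤ ρ * σ.total

/-! ### Log-specific properties -/

/-- A log-specific property is a predicate `Q` on sets of logs. It is a safety property if it is
inherited by subsets and its violation always shows in a finite subset. -/
def IsSafety {T : Type*} (Q : Set (List T) → Prop) : Prop :=
  (∀ A B, B ⊆ A → Q A → Q B) ∧ ∀ A, ¬ Q A → ∃ F ⊆ A, F.Finite ∧ ¬ Q F

/-- `Q` is composable if, for every log `L`, it passes from (all sets of) logs up to `L` and
(all sets of) pairwise consistent logs beyond `L` to the (subsets of the) union. -/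
def IsComposable {T : Type*} (Q : Set (List T) → Prop) : Prop :=
  ∀ (L : List T) (A B : Set (List T)),
    (∀ a ∈ A, a <+: L) → (∀ b ∈ B, L <+: b ∧ b ≠ L) →
    (∀ b ∈ B, ∀ b' ∈ B, LogConsistent b b') →
    (∀ A' ⊆ A, Q A') → (∀ B' ⊆ B, Q B') → ∀ C ⊆ A ∪ B, Q C

/-- `M` satisfies `Q` in a given setting: the logs of every execution in the setting have the
property, from every genesis log that itself conforms to it. -/
def Satisfies {Node T : Type*} (M : Protocol Node T) (Δ : ℕ)
    (setting : ∀ g, Execution M Δ g → Prop) (Q : Set (List T) → Prop) : Prop :=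
  ∀ g (E : Execution M Δ g), setting g E → Q {g} → Q E.logs

/-! ### The transformation -/

/-- Messages of the transformed protocol: messages of the run of the permissioned protocol from
the genesis log `base`; bundles of signatures on logs; transactions. -/
inductive TMsg (Id App Msg : Type*) where
  | sim (base : Log Id App) (m : Msg)
  | votes (V : Set (Id × Log Id App))
  | tx (x : Tx Id App)

/-- Signatures of the transformed protocol: those of the permissioned protocol, bound to the run
they are made in, and signatures of identifiers on logs. -/
inductive TSig (Id App Sig : Type*) where
  | sim (base : Log Id App) (s : Sig)
  | vote (id : Id) (L : Log Id App)

/-- The state of a node in the transformed protocol: its log; the signatures on logs, the messages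
of the permissioned protocol and the transactions received so far; the genesis log `base` of
the run of the permissioned protocol it takes part in, with the state `sim id` of each of its
identifiers in that run; the number of timeslots spent in the run. -/
structure TState (Id App Msg St : Type*) where
  log : Log Id App
  votes : Set (Id × Log Id App)
  inbox : Set (Log Id App × Msg)
  pool : Set (Tx Id App)
  base : Log Id App
  sim : Id → St
  timer : ℕ

section Transformation

variable {Id App : Type*} (P : Protocol Id (Tx Id App)) (σ : Stake Id App) (ρ : ℝ) (Δ ell : ℕ)
  (pick : Set (Log Id App) → Log Id App)

/-- Nodes start with the run of the permissioned protocol from the genesis log. -/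
def tInit (g : Log Id App) : TState Id App P.Msg P.State where
  log := g
  votes := ∅
  inbox := ∅
  pool := ∅
  base := g
  sim := P.init g
  timer := 0

open Classical in
/-- One timeslot of a node with identifiers `ids` in the transformed protocol with genesis
log `g`. The node
* adopts a fully-certified log that strictly extends its log, if it has received one
  (`pick` selects one of them), and gossips the signatures on its prefixes;
* if it thereby reaches a new epoch, quits the current run of the permissioned protocol, and starts
  the one whose genesis log is the log that completed the last epoch;
* executes one timeslot of that run for each of its identifiers that is a validator, and signs all
  newly obtained logs that belong to the epoch of the run;
* gossips newly received transactions and, after `ell + Δ` timeslots in the run, issues the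
  epoch-ending transactions of its validators. -/
noncomputable def tStep (g : Log Id App) (ids : Set Id) (s : TState Id App P.Msg P.State)
    (R : Set (TMsg Id App P.Msg)) (X : Set (Tx Id App)) :
    TState Id App P.Msg P.State × Set (TMsg Id App P.Msg) :=
  let votes := s.votes ∪ {v | ∃ V, TMsg.votes V ∈ R ∧ v ∈ V}
  let newIn := {bm : Log Id App × P.Msg | TMsg.sim bm.1 bm.2 ∈ R}
  let newTx := X ∪ {x | TMsg.tx x ∈ R}
  let inbox := s.inbox ∪ newIn
  let pool := s.pool ∪ newTx
  let cand := {L | s.log <+: L ∧ L ≠ s.log ∧ FullyCertified σ ρ g votes L}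
  let log := if cand.Nonempty then pick cand else s.log
  let base := simBase σ ρ g log
  let fresh := base ≠ s.base
  let old : Id → P.State := if fresh then P.init base else s.sim
  let timer := if fresh then 0 else s.timer + 1
  let active := {id | id ∈ ids ∧ id ∈ σ.currentIds base}
  -- A new run also gets what arrived for it earlier.
  let msgIn := {m | (base, m) ∈ if fresh then inbox else newIn}
  let txIn := if fresh then pool else newTx
  let out := fun id => P.step base id (old id) msgIn txIn
  let sim : Id → P.State := fun id => if id ∈ active then (out id).1 else old id
  let obtained := fun id => {L | L <+: P.log (sim id) ∧ ¬ L <+: P.log (old id) ∧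
    base <+: L ∧ L ≠ base ∧ epoch σ ρ g L = epoch σ ρ g base + 1}
  ({ log := log, votes := votes, inbox := inbox, pool := pool, base := base, sim := sim,
     timer := timer },
   {M | ∃ id ∈ active, ∃ m ∈ (out id).2, M = TMsg.sim base m} ∪
   {M | ∃ id ∈ active, ∃ L ∈ obtained id, M = TMsg.votes {(id, L)}} ∪
   {M | log ≠ s.log ∧ M = TMsg.votes {v ∈ votes | v.2 <+: log}} ∪
   {M | ∃ x ∈ newTx \ s.pool, M = TMsg.tx x} ∪
   {M | timer = ell + Δ ∧ ∃ id ∈ active, M = TMsg.tx (Tx.finish id (epoch σ ρ g base + 1))})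

/-- The transformed protocol, where `owner id` is the node that the identifier `id` belongs to. -/
noncomputable def transform {Node : Type*} (owner : Id → Node) : Protocol Node (Tx Id App) where
  State := TState Id App P.Msg P.State
  Msg := TMsg Id App P.Msg
  Sig := TSig Id App P.Sig
  init := fun g _ => tInit P g
  step := fun g p => tStep P σ ρ Δ ell pick g {id | owner id = p}
  log := TState.log
  sigs := fun
    | TMsg.sim base m => {s | ∃ s' ∈ P.sigs m, s = TSig.sim base s'}
    | TMsg.votes V => {s | ∃ v ∈ V, s = TSig.vote v.1 v.2}
    | TMsg.tx _ => ∅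
  signer := fun
    | TSig.sim _ s => owner (P.signer s)
    | TSig.vote id _ => owner id
  log_init := fun _ _ => rfl

end Transformation

/-! Each epoch is governed by one run of `P`, started from the completed log `B` that ended the
previous epoch. Whatever correct nodes do in this run up to any finite time is also possible in a
permissioned execution of `P` from `B`. An identifier whose node has not yet reached the run, has
left it, or is idle is declared waiting. This is legal because GST is unknown: `runExecution` places
it at a cutoff `T`, after which all validators step and every message is delivered at once. Since
signatures are bound to `B`, forgery is no easier than in `P`, and since `B` is a log of a correct
node, the faulty validators of the run hold at most a `ρ` fraction of its stake.

A certified log carries signatures of at least `1 - ρ > ρ` of the stake, so a correct validator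
signed it (`exists_running_of_mem_votes`) and therefore held an extension of it in the run from its
base. Full certification extends this to all logs of correct nodes and their prefixes: each one
other than `g` is a log of the run from its base, for all large `T` (`exists_mem_logs`).

Consistency follows by induction on epochs: logs of the same epoch have the same base, hence lie in
one consistent execution (`logConsistent_of_mem_logs`). A violation of `Q` within an epoch would
show in finitely many logs, hence in one execution of `P` (`satisfies_logs_of_baseLog_eq`).
Composability at `B` then joins the epochs one after the other (`satisfies_logs_of_epoch_le`), and
safety reduces the whole set of logs to finitely many epochs. -/

theorem LogConsistent.of_prefix {T : Type*} {L L' M M' : List T} (h : LogConsistent M M')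
    (hL : L <+: M) (hL' : L' <+: M') : LogConsistent L L' := by
  rcases h with h | h
  · exact List.prefix_or_prefix_of_prefix (hL.trans h) hL'
  · exact List.prefix_or_prefix_of_prefix hL (hL'.trans h)

theorem List.IsPrefix.rightInduction {T : Type*} {g : List T} {motive : List T → Prop}
    (base : motive g) (append : ∀ L x, g <+: L → motive L → motive (L ++ [x]))
    {L : List T} (h : g <+: L) : motive L := by
  obtain ⟨l, rfl⟩ := h
  induction l using List.reverseRecOn with
  | nil => simpa using base
  | append_singleton l x ih =>
    rw [← List.append_assoc]
    exact append _ _ (List.prefix_append _ _) ih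

/-! ### Epochs, completed logs and bases -/

section EpochLemmas

variable {Id App : Type*} (σ : Stake Id App) (ρ : ℝ) {g : Log Id App}

theorem epochInfo_genesis : epochInfo σ ρ g g =
    { log := g, epoch := 0, base := g, canComplete := True, earlier := False } := by
  simp [epochInfo]

theorem epochInfo_append {L : Log Id App} (h : g <+: L) (x : Tx Id App) :
    epochInfo σ ρ g (L ++ [x]) = (epochInfo σ ρ g L).next σ ρ x := by
  simp [epochInfo, List.drop_append_of_le_length h.length_le]

theorem epochInfo_log {L : Log Id App} (h : g <+: L) : (epochInfo σ ρ g L).log = L := by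
  refine h.rightInduction (motive := fun L => (epochInfo σ ρ g L).log = L) ?_ ?_
  · simp [epochInfo_genesis]
  · intro L x hL ih
    rw [epochInfo_append σ ρ hL, EpochInfo.next]
    split_ifs <;> simp [ih]

theorem completed_genesis : completed σ ρ g g := by
  simp [completed, EpochInfo.completed, epochInfo_genesis]

theorem epoch_genesis : epoch σ ρ g g = 0 := by
  simp [epoch, epochInfo_genesis]

theorem baseLog_genesis : baseLog σ ρ g g = g := by
  simp [baseLog, epochInfo_genesis]

theorem simBase_genesis : simBase σ ρ g g = g := by
  simp [simBase, baseLog_genesis]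

theorem epoch_append_of_completed {L : Log Id App} (h : g <+: L) (hc : completed σ ρ g L)
    (x : Tx Id App) : epoch σ ρ g (L ++ [x]) = epoch σ ρ g L + 1 := by
  rw [completed] at hc
  simp [epoch, epochInfo_append σ ρ h, EpochInfo.next, hc]

theorem baseLog_append_of_completed {L : Log Id App} (h : g <+: L) (hc : completed σ ρ g L)
    (x : Tx Id App) : baseLog σ ρ g (L ++ [x]) = L := by
  rw [completed] at hc
  simp [baseLog, epochInfo_append σ ρ h, EpochInfo.next, hc, epochInfo_log σ ρ h]

theorem epoch_append_of_not_completed {L : Log Id App} (h : g <+: L)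
    (hc : ¬ completed σ ρ g L) (x : Tx Id App) :
    epoch σ ρ g (L ++ [x]) = epoch σ ρ g L := by
  rw [completed] at hc
  simp [epoch, epochInfo_append σ ρ h, EpochInfo.next, hc]

theorem baseLog_append_of_not_completed {L : Log Id App} (h : g <+: L)
    (hc : ¬ completed σ ρ g L) (x : Tx Id App) :
    baseLog σ ρ g (L ++ [x]) = baseLog σ ρ g L := by
  rw [completed] at hc
  simp [baseLog, epochInfo_append σ ρ h, EpochInfo.next, hc]

theorem baseLog_spec {L : Log Id App} (h : g <+: L) :
    g <+: baseLog σ ρ g L ∧ baseLog σ ρ g L <+: L ∧ completed σ ρ g (baseLog σ ρ g L) ∧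
      (L ≠ g → epoch σ ρ g L = epoch σ ρ g (baseLog σ ρ g L) + 1) := by
  refine h.rightInduction (motive := fun L => g <+: baseLog σ ρ g L ∧ baseLog σ ρ g L <+: L ∧
    completed σ ρ g (baseLog σ ρ g L) ∧
      (L ≠ g → epoch σ ρ g L = epoch σ ρ g (baseLog σ ρ g L) + 1)) ?_ ?_
  · simp [baseLog_genesis, completed_genesis]
  · intro L x hL ⟨h1, h2, h3, h4⟩
    by_cases hc : completed σ ρ g L
    · rw [baseLog_append_of_completed σ ρ hL hc]
      exact ⟨hL, List.prefix_append _ _, hc, fun _ => epoch_append_of_completed σ ρ hL hc x⟩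
    · rw [baseLog_append_of_not_completed σ ρ hL hc, epoch_append_of_not_completed σ ρ hL hc]
      -- The genesis log is completed, so an uncompleted predecessor differs from it and the
      -- induction hypothesis gives its epoch.
      exact ⟨h1, h2.trans (List.prefix_append _ _), h3,
        fun _ => h4 fun e => hc (e ▸ completed_genesis σ ρ)⟩

theorem genesis_prefix_baseLog {L : Log Id App} (h : g <+: L) : g <+: baseLog σ ρ g L :=
  (baseLog_spec σ ρ h).1

theorem baseLog_prefix {L : Log Id App} (h : g <+: L) : baseLog σ ρ g L <+: L :=
  (baseLog_spec σ ρ h).2.1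

theorem completed_baseLog {L : Log Id App} (h : g <+: L) :
    completed σ ρ g (baseLog σ ρ g L) :=
  (baseLog_spec σ ρ h).2.2.1

theorem epoch_eq_epoch_baseLog_add_one {L : Log Id App} (h : g <+: L) (hne : L ≠ g) :
    epoch σ ρ g L = epoch σ ρ g (baseLog σ ρ g L) + 1 :=
  (baseLog_spec σ ρ h).2.2.2 hne

theorem baseLog_ne {L : Log Id App} (h : g <+: L) (hne : L ≠ g) : baseLog σ ρ g L ≠ L := by
  intro e
  have := epoch_eq_epoch_baseLog_add_one σ ρ h hne
  rw [e] at this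
  omega

theorem epoch_mono {L L' : Log Id App} (h : g <+: L) (h' : L <+: L') :
    epoch σ ρ g L ≤ epoch σ ρ g L' := by
  refine h'.rightInduction (motive := fun L' => epoch σ ρ g L ≤ epoch σ ρ g L') le_rfl ?_
  intro M x hM ih
  by_cases hc : completed σ ρ g M
  · rw [epoch_append_of_completed σ ρ (h.trans hM) hc]; omega
  · rwa [epoch_append_of_not_completed σ ρ (h.trans hM) hc]

theorem epoch_lt_of_completed {L L' : Log Id App} (h : g <+: L) (hc : completed σ ρ g L)
    (h' : L <+: L') (hne : L ≠ L') : epoch σ ρ g L < epoch σ ρ g L' := by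
  obtain ⟨l, rfl⟩ := h'
  cases l with
  | nil => simp at hne
  | cons x l =>
    have h1 : L ++ [x] <+: L ++ x :: l := ⟨l, by simp⟩
    have h2 := epoch_mono σ ρ (h.trans (List.prefix_append L [x])) h1
    rw [epoch_append_of_completed σ ρ h hc] at h2
    omega

/-- Any transaction after a completed log opens a new epoch, so of two consistent logs of one epoch
the shorter cannot be completed. -/
theorem eq_of_completed_of_epoch_eq {L L' : Log Id App} (h : g <+: L) (h' : g <+: L')
    (hc : completed σ ρ g L) (hc' : completed σ ρ g L')
    (he : epoch σ ρ g L = epoch σ ρ g L') (hLL : LogConsistent L L') : L = L' := by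
  by_contra hne
  rcases hLL with hp | hp
  · have := epoch_lt_of_completed σ ρ h hc hp hne; omega
  · have := epoch_lt_of_completed σ ρ h' hc' hp (Ne.symm hne); omega

theorem eq_genesis_of_epoch_eq_zero {L : Log Id App} (h : g <+: L)
    (he : epoch σ ρ g L = 0) : L = g := by
  by_contra hne
  have := epoch_eq_epoch_baseLog_add_one σ ρ h hne
  omega

/-- The base of a log is its only completed prefix of the preceding epoch. -/
theorem baseLog_eq_of_completed {B L : Log Id App} (hg : g <+: B) (hc : completed σ ρ g B)
    (hBL : B <+: L) (he : epoch σ ρ g L = epoch σ ρ g B + 1) : baseLog σ ρ g L = B := by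
  have hL := hg.trans hBL
  have hne : L ≠ g := by
    rintro rfl
    rw [epoch_genesis] at he
    omega
  have := epoch_eq_epoch_baseLog_add_one σ ρ hL hne
  exact eq_of_completed_of_epoch_eq σ ρ (genesis_prefix_baseLog σ ρ hL) hg
    (completed_baseLog σ ρ hL) hc (by omega)
    (List.prefix_or_prefix_of_prefix (baseLog_prefix σ ρ hL) hBL)

theorem baseLog_eq_of_epoch_eq {L L' : Log Id App} (h : g <+: L) (hne : L ≠ g)
    (h' : L <+: L') (he : epoch σ ρ g L' = epoch σ ρ g L) :
    baseLog σ ρ g L' = baseLog σ ρ g L :=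
  baseLog_eq_of_completed σ ρ (genesis_prefix_baseLog σ ρ h) (completed_baseLog σ ρ h)
    ((baseLog_prefix σ ρ h).trans h') (he.trans (epoch_eq_epoch_baseLog_add_one σ ρ h hne))

/-- An epoch that ends between `L` and `L'` is ended by a completed log between them. -/
theorem exists_completed_of_epoch_lt {L L' : Log Id App} (h : g <+: L) (h' : L <+: L')
    (hlt : epoch σ ρ g L < epoch σ ρ g L') :
    ∃ M, L <+: M ∧ M <+: L' ∧ completed σ ρ g M ∧ epoch σ ρ g M = epoch σ ρ g L := by
  revert hlt
  refine h'.rightInduction (motive := fun L' => epoch σ ρ g L < epoch σ ρ g L' →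
    ∃ M, L <+: M ∧ M <+: L' ∧ completed σ ρ g M ∧ epoch σ ρ g M = epoch σ ρ g L)
    (fun h => absurd h (lt_irrefl _)) ?_
  intro N x hN ih hlt
  by_cases hlt' : epoch σ ρ g L < epoch σ ρ g N
  · obtain ⟨M, h1, h2, h3⟩ := ih hlt'
    exact ⟨M, h1, h2.trans (List.prefix_append _ _), h3⟩
  · have hle := epoch_mono σ ρ h hN
    by_cases hc : completed σ ρ g N
    · exact ⟨N, hN, List.prefix_append _ _, hc, by omega⟩
    · rw [epoch_append_of_not_completed σ ρ (h.trans hN) hc] at hlt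
      exact absurd hlt hlt'

theorem genesis_prefix_simBase {L : Log Id App} (h : g <+: L) : g <+: simBase σ ρ g L := by
  unfold simBase
  split_ifs
  exacts [h, genesis_prefix_baseLog σ ρ h]

theorem completed_simBase {L : Log Id App} (h : g <+: L) :
    completed σ ρ g (simBase σ ρ g L) := by
  unfold simBase
  split_ifs with hc
  exacts [hc, completed_baseLog σ ρ h]

/-- Nodes only move forward from run to run; in particular, they never return to a run that they
quit. -/
theorem simBase_mono {L L' : Log Id App} (h : g <+: L) (h' : L <+: L') :
    simBase σ ρ g L <+: simBase σ ρ g L' := by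
  refine h'.rightInduction (motive := fun L' => simBase σ ρ g L <+: simBase σ ρ g L')
    (List.prefix_refl _) ?_
  intro M x hM ih
  refine ih.trans ?_
  have hgM := h.trans hM
  -- The run of a log starts from the base of each of its one-transaction extensions.
  have hpre : simBase σ ρ g M = baseLog σ ρ g (M ++ [x]) := by
    by_cases hc : completed σ ρ g M
    · rw [baseLog_append_of_completed σ ρ hgM hc, simBase, if_pos hc]
    · rw [baseLog_append_of_not_completed σ ρ hgM hc, simBase, if_neg hc]
  rw [hpre, simBase]
  split_ifs
  exacts [baseLog_prefix σ ρ (hgM.trans (List.prefix_append _ _)), List.prefix_refl _]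

end EpochLemmas

/-! ### Stake of correct validators -/

theorem Stake.weight_mono {Id App : Type*} (σ : Stake Id App) (L : Log Id App) {A A' : Set Id}
    (h : A ⊆ A') : σ.weight L A ≤ σ.weight L A' := by
  classical
  unfold Stake.weight
  refine Finset.sum_le_sum_of_subset_of_nonneg ?_ fun _ _ _ => NNReal.coe_nonneg _
  intro id
  simp only [Finset.mem_filter]
  exact fun h' => ⟨h'.1, h h'.2⟩

/-- As `ρ < 1 - ρ` and the total stake is positive, a certifying set is too heavy to consist of
faulty identifiers only. -/
theorem Stake.exists_mem_not_mem {Id App : Type*} (σ : Stake Id App) {ρ : ℝ} (hρ : ρ < 1 / 2)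
    {L : Log Id App} {A F : Set Id} (hA : (1 - ρ) * σ.total ≤ σ.weight L A)
    (hF : σ.weight L F ≤ ρ * σ.total) : ∃ id ∈ A, id ∉ F := by
  by_contra! h
  have h1 := σ.weight_mono L (show A ⊆ F from h)
  have h2 : (0 : ℝ) < σ.total := NNReal.coe_pos.2 σ.total_pos
  nlinarith

/-! ### One timeslot of the transformed protocol -/

section Step

variable {Id App : Type*} (P : Protocol Id (Tx Id App)) (σ : Stake Id App) (ρ : ℝ) (Δ ell : ℕ)
  (pick : Set (Log Id App) → Log Id App)

open Classical in
/-- The state of the permissioned protocol from which a transition from `s` to `s'` goes on. -/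
noncomputable def simOld (s s' : TState Id App P.Msg P.State) : Id → P.State :=
  if s'.base ≠ s.base then P.init s'.base else s.sim

open Classical in
/-- The messages that the run of the permissioned protocol reads in a transition from `s`
to `s'` in which the messages `R` are received. -/
noncomputable def simMsgs (s s' : TState Id App P.Msg P.State) (R : Set (TMsg Id App P.Msg)) :
    Set P.Msg :=
  {m | (s'.base, m) ∈ if s'.base ≠ s.base then s'.inbox
    else {bm : Log Id App × P.Msg | TMsg.sim bm.1 bm.2 ∈ R}}

open Classical in
/-- The transactions that the run of the permissioned protocol reads in a transition from `s`
to `s'` in which the messages `R` and the transactions `X` are received. -/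
noncomputable def simTxs (s s' : TState Id App P.Msg P.State) (R : Set (TMsg Id App P.Msg))
    (X : Set (Tx Id App)) : Set (Tx Id App) :=
  if s'.base ≠ s.base then s'.pool else X ∪ {x | TMsg.tx x ∈ R}

variable {P σ ρ Δ ell pick} {g : Log Id App} {ids : Set Id} {s s' : TState Id App P.Msg P.State}
  {R O : Set (TMsg Id App P.Msg)} {X : Set (Tx Id App)}

theorem tStep_votes (h : (s', O) = tStep P σ ρ Δ ell pick g ids s R X) :
    s'.votes = s.votes ∪ {v | ∃ V, TMsg.votes V ∈ R ∧ v ∈ V} := by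
  rw [show s' = _ from congrArg Prod.fst h]; rfl

theorem tStep_inbox (h : (s', O) = tStep P σ ρ Δ ell pick g ids s R X) :
    s'.inbox = s.inbox ∪ {bm : Log Id App × P.Msg | TMsg.sim bm.1 bm.2 ∈ R} := by
  rw [show s' = _ from congrArg Prod.fst h]; rfl

theorem tStep_base (h : (s', O) = tStep P σ ρ Δ ell pick g ids s R X) :
    s'.base = simBase σ ρ g s'.log := by
  rw [show s' = _ from congrArg Prod.fst h]; rfl

theorem tStep_log (hpick : ∀ s, s.Nonempty → pick s ∈ s)
    (h : (s', O) = tStep P σ ρ Δ ell pick g ids s R X) :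
    s'.log = s.log ∨ (s.log <+: s'.log ∧ FullyCertified σ ρ g s'.votes s'.log) := by
  classical
  have hv := tStep_votes h
  have hl : s'.log = if {L | s.log <+: L ∧ L ≠ s.log ∧ FullyCertified σ ρ g s'.votes L}.Nonempty
      then pick {L | s.log <+: L ∧ L ≠ s.log ∧ FullyCertified σ ρ g s'.votes L} else s.log := by
    rw [hv, show s' = _ from congrArg Prod.fst h]
    simp only [tStep]
  split_ifs at hl with hne
  · right
    rw [hl]
    exact ⟨(hpick _ hne).1, (hpick _ hne).2.2⟩
  · exact Or.inl hl

theorem tStep_sim (h : (s', O) = tStep P σ ρ Δ ell pick g ids s R X) {id : Id} (hid : id ∈ ids)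
    (hc : id ∈ σ.currentIds s'.base) :
    s'.sim id = (P.step s'.base id (simOld P s s' id) (simMsgs P s s' R) (simTxs P s s' R X)).1 := by
  have hs := (Prod.ext_iff.1 h).1
  dsimp only at hs
  subst hs
  exact if_pos ⟨hid, hc⟩

theorem tStep_sent_sim (h : (s', O) = tStep P σ ρ Δ ell pick g ids s R X) {B : Log Id App}
    {m : P.Msg} (hm : TMsg.sim B m ∈ O) : s'.base = B ∧ ∃ id ∈ ids, id ∈ σ.currentIds B ∧
      m ∈ (P.step B id (simOld P s s' id) (simMsgs P s s' R) (simTxs P s s' R X)).2 := by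
  have hs := (Prod.ext_iff.1 h).1
  have hO := (Prod.ext_iff.1 h).2
  dsimp only at hs hO
  rw [hO] at hm
  subst hs
  rcases hm with (((hm | hm) | hm) | hm) | hm
  · obtain ⟨id, hid, m', hm', e⟩ := hm
    injection e with e1 e2
    subst e1 e2
    exact ⟨rfl, id, hid.1, hid.2, hm'⟩
  · obtain ⟨_, _, _, _, e⟩ := hm; cases e
  · cases hm.2
  · obtain ⟨_, _, e⟩ := hm; cases e
  · obtain ⟨_, _, _, e⟩ := hm; cases e

/-- Only two kinds of output carry signatures on logs: gossip of known ones, and fresh ones on logs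
obtained in the current run. -/
theorem tStep_sent_votes (h : (s', O) = tStep P σ ρ Δ ell pick g ids s R X)
    {V : Set (Id × Log Id App)} (hm : TMsg.votes V ∈ O) {id : Id} {L : Log Id App}
    (hV : (id, L) ∈ V) : (id, L) ∈ s'.votes ∨
      (id ∈ ids ∧ id ∈ σ.currentIds s'.base ∧ L <+: P.log (s'.sim id) ∧ s'.base <+: L ∧
        epoch σ ρ g L = epoch σ ρ g s'.base + 1) := by
  have hs := (Prod.ext_iff.1 h).1
  have hO := (Prod.ext_iff.1 h).2
  dsimp only at hs hO
  rw [hO] at hm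
  subst hs
  rcases hm with (((hm | hm) | hm) | hm) | hm
  · obtain ⟨_, _, _, _, e⟩ := hm; cases e
  · obtain ⟨id', hid, L', hL, e⟩ := hm
    injection e with e
    subst e
    obtain ⟨rfl, rfl⟩ := Prod.ext_iff.1 (Set.mem_singleton_iff.1 hV)
    exact Or.inr ⟨hid.1, hid.2, hL.1, hL.2.2.1, hL.2.2.2.2⟩
  · obtain ⟨_, e⟩ := hm
    injection e with e
    subst e
    exact Or.inl hV.1
  · obtain ⟨_, _, e⟩ := hm; cases e
  · obtain ⟨_, _, _, e⟩ := hm; cases e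

end Step

theorem Execution.mem_logs_of_prefix {Node T : Type*} {M : Protocol Node T} {Δ : ℕ}
    {g : List T} (E : Execution M Δ g) {L L' : List T} (hL' : L' ∈ E.logs) (hg : g <+: L)
    (h : L <+: L') : L ∈ E.logs := by
  obtain ⟨_, p, hp, t, ht⟩ := hL'
  exact ⟨hg, p, hp, t, h.trans ht⟩

/-! ### The simulated runs as permissioned executions -/

section Simulation

variable {Id App Node : Type*} {P : Protocol Id (Tx Id App)} {σ : Stake Id App} {ρ : ℝ}
  {Δ ell : ℕ} {pick : Set (Log Id App) → Log Id App} {owner : Id → Node} {g : Log Id App}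
  (E : Execution (transform P σ ρ Δ ell pick owner) Δ g)

/-- The state of a node, as a state of the transformed protocol. -/
def tState (p : Node) (t : ℕ) : TState Id App P.Msg P.State := E.state p t

theorem tState_zero {p : Node} (hp : p ∉ E.faulty) : tState E p 0 = tInit P g :=
  E.state_zero p hp

theorem tState_step {p : Node} (hp : p ∉ E.faulty) {t : ℕ} (ha : E.active p t)
    (hw : ¬ E.waiting p t) : (tState E p (t + 1), E.sent p t) =
      tStep P σ ρ Δ ell pick g {id | owner id = p} (tState E p t) (E.received p t) (E.txs p t) :=
  E.run p hp t ha hw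

theorem tState_cases {p : Node} (hp : p ∉ E.faulty) (t : ℕ) :
    (tState E p (t + 1) = tState E p t ∧ E.sent p t = ∅ ∧ ¬ (E.active p t ∧ ¬ E.waiting p t)) ∨
      (E.active p t ∧ ¬ E.waiting p t) := by
  by_cases h : E.active p t ∧ ¬ E.waiting p t
  · exact Or.inr h
  · have := E.idle p hp t (by tauto)
    exact Or.inl ⟨this.1, this.2.1, h⟩

theorem tState_log_prefix (hpick : ∀ s, s.Nonempty → pick s ∈ s) {p : Node}
    (hp : p ∉ E.faulty) (t : ℕ) : (tState E p t).log <+: (tState E p (t + 1)).log := by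
  rcases tState_cases E hp t with h | h
  · rw [h.1]
  · rcases tStep_log hpick (tState_step E hp h.1 h.2) with h | h
    · rw [h]
    · exact h.1

theorem genesis_prefix_tState_log (hpick : ∀ s, s.Nonempty → pick s ∈ s) {p : Node}
    (hp : p ∉ E.faulty) (t : ℕ) : g <+: (tState E p t).log := by
  induction t with
  | zero => rw [tState_zero E hp]; exact List.prefix_refl _
  | succ t ih => exact ih.trans (tState_log_prefix E hpick hp t)

theorem tState_base {p : Node} (hp : p ∉ E.faulty) (t : ℕ) :
    (tState E p t).base = simBase σ ρ g (tState E p t).log := by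
  induction t with
  | zero => rw [tState_zero E hp]; exact (simBase_genesis σ ρ).symm
  | succ t ih =>
    rcases tState_cases E hp t with h | h
    · rw [h.1, ih]
    · exact tStep_base (tState_step E hp h.1 h.2)

theorem tState_base_prefix (hpick : ∀ s, s.Nonempty → pick s ∈ s) {p : Node}
    (hp : p ∉ E.faulty) (t : ℕ) : (tState E p t).base <+: (tState E p (t + 1)).base := by
  rw [tState_base E hp, tState_base E hp]
  exact simBase_mono σ ρ (genesis_prefix_tState_log E hpick hp t) (tState_log_prefix E hpick hp t)

/-- A log changes only by adoption, so `t'` can be the timeslot just after its adoption. -/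
theorem tState_log_certified (hpick : ∀ s, s.Nonempty → pick s ∈ s) {p : Node}
    (hp : p ∉ E.faulty) (t : ℕ) :
    (tState E p t).log = g ∨
      ∃ t', FullyCertified σ ρ g (tState E p t').votes (tState E p t).log := by
  induction t with
  | zero => rw [tState_zero E hp]; exact Or.inl rfl
  | succ t ih =>
    have hkeep : (tState E p (t + 1)).log = (tState E p t).log → (tState E p (t + 1)).log = g ∨
        ∃ t', FullyCertified σ ρ g (tState E p t').votes (tState E p (t + 1)).log := by
      intro h
      rw [h]
      exact ih
    rcases tState_cases E hp t with h | h
    · exact hkeep (by rw [h.1])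
    · rcases tStep_log hpick (tState_step E hp h.1 h.2) with h | h
      · exact hkeep h
      · exact Or.inr ⟨t + 1, h.2⟩

theorem exists_received_of_mem_inbox {p : Node} (hp : p ∉ E.faulty) {t : ℕ} {B : Log Id App}
    {m : P.Msg} (h : (B, m) ∈ (tState E p t).inbox) :
    ∃ t' < t, TMsg.sim B m ∈ E.received p t' := by
  induction t with
  | zero => rw [tState_zero E hp] at h; exact absurd h (Set.notMem_empty _)
  | succ t ih =>
    have hold : (B, m) ∈ (tState E p t).inbox → ∃ t' < t + 1, TMsg.sim B m ∈ E.received p t' :=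
      fun h => (ih h).imp fun t' h' => ⟨by omega, h'.2⟩
    rcases tState_cases E hp t with h' | h'
    · exact hold (h'.1 ▸ h)
    · rw [tStep_inbox (tState_step E hp h'.1 h'.2)] at h
      exact h.elim hold fun h => ⟨t, by omega, h⟩

/-- In timeslot `t`, the identifier `id` of a correct node takes part in the run of the permissioned
protocol from the genesis log `B`. -/
structure Running (B : Log Id App) (id : Id) (t : ℕ) : Prop where
  correct : owner id ∉ E.faulty
  active : E.active (owner id) t
  not_waiting : ¬ E.waiting (owner id) t
  base_eq : (tState E (owner id) (t + 1)).base = B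
  mem_currentIds : id ∈ σ.currentIds B

/-- Signatures of correct nodes on logs are made in the runs of the permissioned protocol. -/
theorem exists_running_of_mem_votes {t : ℕ} {p : Node} (hp : p ∉ E.faulty) {id : Id}
    (hid : owner id ∉ E.faulty) {L : Log Id App} (h : (id, L) ∈ (tState E p t).votes) :
    ∃ B t', Running E B id t' ∧ L <+: P.log ((tState E (owner id) (t' + 1)).sim id) ∧
      B <+: L ∧ epoch σ ρ g L = epoch σ ρ g B + 1 := by
  induction t using Nat.strong_induction_on generalizing p with
  | _ t ih =>
  cases t with
  | zero => rw [tState_zero E hp] at h; exact absurd h (Set.notMem_empty _)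
  | succ t =>
    rcases tState_cases E hp t with h' | h'
    · exact ih t (by omega) hp (h'.1 ▸ h)
    rw [tStep_votes (tState_step E hp h'.1 h'.2)] at h
    rcases h with h | ⟨V, hV, hvV⟩
    · exact ih t (by omega) hp h
    -- Each hop of gossip leads to a strictly earlier timeslot, so tracing the signature back ends
    -- at the node that made it.
    obtain ⟨q, hq, t', ht', m', hm', hs⟩ := E.unforgeable p hp t _ hV (TSig.vote id L)
      ⟨(id, L), hvV, rfl⟩ hid
    rcases tState_cases E hq t' with hst | hst
    · rw [hst.2.1] at hm'; exact absurd hm' (Set.notMem_empty _)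
    cases m' with
    | sim B m => obtain ⟨_, _, e⟩ := hs; cases e
    | tx x => exact absurd hs (Set.notMem_empty _)
    | votes W =>
      obtain ⟨v, hv, e⟩ := hs
      injection e with e1 e2
      have hv' : (id, L) ∈ W := by rw [e1, e2]; exact hv
      rcases tStep_sent_votes (tState_step E hq hst.1 hst.2) hm' hv' with h | h
      · exact ih (t' + 1) (by omega) hq h
      · obtain ⟨rfl, hcur, hL, hB, he⟩ := h
        exact ⟨_, t', ⟨hid, hst.1, hst.2, rfl, hcur⟩, hL, hB, he⟩

/-- The messages that `id` reads in timeslot `t`, in its current run of the permissioned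
protocol. -/
noncomputable def runMsgs (id : Id) (t : ℕ) : Set P.Msg :=
  simMsgs P (tState E (owner id) t) (tState E (owner id) (t + 1)) (E.received (owner id) t)

/-- The transactions that `id` reads in timeslot `t`, in its current run of the permissioned
protocol. -/
noncomputable def runTxs (id : Id) (t : ℕ) : Set (Tx Id App) :=
  simTxs P (tState E (owner id) t) (tState E (owner id) (t + 1)) (E.received (owner id) t)
    (E.txs (owner id) t)

theorem exists_received_of_mem_runMsgs {B : Log Id App} {id : Id} {t : ℕ} (h : Running E B id t)
    {m : P.Msg} (hm : m ∈ runMsgs E id t) :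
    ∃ t' ≤ t, TMsg.sim B m ∈ E.received (owner id) t' := by
  simp only [runMsgs, simMsgs, h.base_eq, Set.mem_ofPred_eq] at hm
  split_ifs at hm
  · obtain ⟨t', ht', h'⟩ := exists_received_of_mem_inbox E h.correct hm
    exact ⟨t', by omega, h'⟩
  · exact ⟨t, le_rfl, hm⟩

/-- Does `id` make a transition in timeslot `t`, if the run from `B` is followed until timeslot `T`,
and then continued by all validators? -/
def Stepping (B : Log Id App) (T : ℕ) (id : Id) (t : ℕ) : Prop :=
  id ∈ σ.currentIds B ∧ (t < T → Running E B id t)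

open Classical in
/-- The transition of `id` in timeslot `t`, given its state and the messages that correct nodes
sent so far: until timeslot `T` that of the run from `B`; thereafter all of
these messages are received. -/
noncomputable def runStep (B : Log Id App) (T : ℕ) (id : Id) (t : ℕ) (st : P.State)
    (H : Set P.Msg) : P.State × Set P.Msg :=
  if Stepping E B T id t then
    P.step B id st (if t < T then runMsgs E id t else H) (runTxs E id t) else (st, ∅)

/-- The states of the identifiers at timeslot `t` in the run from `B`, and the messages that correct
nodes sent in it before. -/
noncomputable def runState (B : Log Id App) (T : ℕ) : ℕ → (Id → P.State) × Set P.Msg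
  | 0 => (P.init B, ∅)
  | t + 1 => (fun id => (runStep E B T id t ((runState B T t).1 id) (runState B T t).2).1,
      (runState B T t).2 ∪ {m | ∃ id, owner id ∉ E.faulty ∧
        m ∈ (runStep E B T id t ((runState B T t).1 id) (runState B T t).2).2})

noncomputable def runSent (B : Log Id App) (T : ℕ) (id : Id) (t : ℕ) : Set P.Msg :=
  (runStep E B T id t ((runState E B T t).1 id) (runState E B T t).2).2

/-- The accumulated set is exactly the past traffic of correct nodes. Delivering it after the cutoff
thus omits nothing and forges nothing. -/
theorem mem_runState_snd {B : Log Id App} {T t : ℕ} {m : P.Msg} :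
    m ∈ (runState E B T t).2 ↔ ∃ id, owner id ∉ E.faulty ∧ ∃ t' < t, m ∈ runSent E B T id t' := by
  induction t with
  | zero => simp [runState]
  | succ t ih =>
    rw [runState]
    simp only [Set.mem_union, ih, Set.mem_ofPred_eq]
    constructor
    · rintro (⟨id, h1, t', h2, h3⟩ | ⟨id, h1, h2⟩)
      · exact ⟨id, h1, t', by omega, h3⟩
      · exact ⟨id, h1, t, by omega, h2⟩
    · rintro ⟨id, h1, t', h2, h3⟩
      rcases Nat.lt_succ_iff_lt_or_eq.1 h2 with h | rfl
      · exact Or.inl ⟨id, h1, t', h, h3⟩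
      · exact Or.inr ⟨id, h1, h3⟩

/-- Until timeslot `T`, the run from `B` has the states that the transformed protocol simulates. -/
theorem runState_eq (hpick : ∀ s, s.Nonempty → pick s ∈ s) {B : Log Id App} {T : ℕ} {id : Id}
    (hid : owner id ∉ E.faulty) (hB : id ∈ σ.currentIds B) {t : ℕ} (ht : t ≤ T) :
    ((tState E (owner id) t).base = B →
      (runState E B T t).1 id = (tState E (owner id) t).sim id) ∧
    ((tState E (owner id) t).base ≠ B → (tState E (owner id) t).base <+: B →
      (runState E B T t).1 id = P.init B id) := by
  induction t with
  | zero =>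
    rw [tState_zero E hid]
    refine ⟨?_, fun _ _ => rfl⟩
    rintro rfl
    rfl
  | succ t ih =>
    obtain ⟨ih1, ih2⟩ := ih (by omega)
    have hlt : t < T := by omega
    have hpre := tState_base_prefix E hpick hid t
    -- Before the cutoff, the constructed state changes only in timeslots in which `id` takes part
    -- in the run from `B`.
    have hstay : ¬ Running E B id t → (runState E B T (t + 1)).1 id = (runState E B T t).1 id := by
      intro h
      have : ¬ Stepping E B T id t := fun h' => h (h'.2 hlt)
      simp [runState, runStep, this]
    rcases tState_cases E hid t with h | h
    · rw [hstay fun hr => h.2.2 ⟨hr.active, hr.not_waiting⟩, h.1]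
      exact ⟨ih1, ih2⟩
    · constructor
      · intro hb
        have hS : Stepping E B T id t := ⟨hB, fun _ => ⟨hid, h.1, h.2, hb, hB⟩⟩
        have hsim := tStep_sim (tState_step E hid h.1 h.2) rfl (by rw [hb]; exact hB)
        have hold : simOld P (tState E (owner id) t) (tState E (owner id) (t + 1)) id =
            (runState E B T t).1 id := by
          rw [simOld, hb]
          split_ifs with hf
          -- The node has just entered the run: its earlier base lies strictly before `B`, so both
          -- sides are the initial state.
          · exact (ih2 (Ne.symm hf) (hb ▸ hpre)).symm
          · exact (ih1 (not_not.1 hf).symm).symm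
        rw [hsim, hold, hb]
        simp only [runState, runStep, if_pos hS, if_pos hlt, runMsgs, runTxs]
      · intro hb hbp
        rw [hstay fun hr => hb hr.base_eq]
        -- The base cannot have been `B` before: bases only grow, and the new one is still a prefix
        -- of `B`.
        refine ih2 (fun e => hb ?_) (hpre.trans hbp)
        rw [e] at hpre
        exact hbp.eq_of_length_le hpre.length_le

theorem Running.simOld_eq (hpick : ∀ s, s.Nonempty → pick s ∈ s) {B : Log Id App} {T : ℕ}
    {id : Id} {t : ℕ} (h : Running E B id t) (ht : t ≤ T) :
    simOld P (tState E (owner id) t) (tState E (owner id) (t + 1)) id =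
      (runState E B T t).1 id := by
  obtain ⟨h1, h2⟩ := runState_eq E hpick h.correct h.mem_currentIds ht
  have hpre := tState_base_prefix E hpick h.correct t
  rw [simOld]
  rw [h.base_eq] at hpre ⊢
  split_ifs with hf
  · exact (h2 (Ne.symm hf) hpre).symm
  · exact (h1 (not_not.1 hf).symm).symm

/-- Messages of correct nodes for the run from `B` were sent in this run. -/
theorem mem_runSent_of_mem_sent (hpick : ∀ s, s.Nonempty → pick s ∈ s) {B : Log Id App} {T : ℕ}
    {p : Node} (hp : p ∉ E.faulty) {t : ℕ} (ht : t < T) {m : P.Msg}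
    (hm : TMsg.sim B m ∈ E.sent p t) : ∃ id, owner id ∉ E.faulty ∧ m ∈ runSent E B T id t := by
  rcases tState_cases E hp t with h | h
  · rw [h.2.1] at hm; exact absurd hm (Set.notMem_empty _)
  · obtain ⟨hb, id, rfl, hc, hm⟩ := tStep_sent_sim (tState_step E hp h.1 h.2) hm
    have hrun : Running E B id t := ⟨hp, h.1, h.2, hb, hc⟩
    have hS : Stepping E B T id t := ⟨hc, fun _ => hrun⟩
    refine ⟨id, hp, ?_⟩
    rw [runSent, runStep, if_pos hS, if_pos ht, ← hrun.simOld_eq E hpick ht.le]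
    exact hm

open Classical in
/-- The run of the permissioned protocol from `B` that the transformed protocol simulates until
timeslot `T`, as an execution of the permissioned protocol: identifiers wait whenever they do not
take part in the run. From `T` on, no one waits, and all messages are delivered at once. -/
noncomputable def runExecution (hpick : ∀ s, s.Nonempty → pick s ∈ s) (hΔ : 0 < Δ)
    (B : Log Id App) (T : ℕ) : Execution P Δ B where
  faulty := {id | owner id ∈ E.faulty}
  GST := T
  active id _ := id ∈ σ.currentIds B
  waiting id t := t < T ∧ ¬ Running E B id t
  state id t := (runState E B T t).1 id
  -- An identifier that does not step must receive nothing, by the field `idle`.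
  received id t := if Stepping E B T id t then
    (if t < T then runMsgs E id t else (runState E B T t).2) else ∅
  txs id t := runTxs E id t
  sent id t := runSent E B T id t
  waiting_lt _ _ _ h := h.1
  state_zero _ _ := rfl
  run id _ t ha hw := by
    have hS : Stepping E B T id t := ⟨ha, fun ht => by_contra fun h => hw ⟨ht, h⟩⟩
    simp [runSent, runState, runStep, hS]
  idle id _ t h := by
    have hS : ¬ Stepping E B T id t := fun hS =>
      h.elim (fun h => h hS.1) fun h => h.2 (hS.2 h.1)
    simp [runSent, runState, runStep, hS]
  unforgeable id hid t m hm s hs hsig := by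
    split_ifs at hm with hS ht
    · obtain ⟨t', ht', hm'⟩ := exists_received_of_mem_runMsgs E (hS.2 ht) hm
      -- The signature names its run, so the correct message that carried it belongs to the run from
      -- `B`. It was sent before `t' ≤ t < T`, where the constructed run still follows the
      -- simulation.
      obtain ⟨q, hq, t₁, ht₁, m₁, hm₁, hs₁⟩ := E.unforgeable _ hid t' _ hm' (TSig.sim B s)
        ⟨s, hs, rfl⟩ hsig
      cases m₁ with
      | sim B' m₁ =>
        obtain ⟨s', hs', e⟩ := hs₁
        injection e with e1 e2
        subst e1 e2
        obtain ⟨id', h1, h2⟩ := mem_runSent_of_mem_sent E hpick hq (by omega : t₁ < T) hm₁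
        exact ⟨id', h1, t₁, by omega, m₁, h2, hs'⟩
      | votes V => obtain ⟨_, _, e⟩ := hs₁; cases e
      | tx x => exact absurd hs₁ (Set.notMem_empty _)
    · obtain ⟨id', h1, t', h2, h3⟩ := (mem_runState_snd E).1 hm
      exact ⟨id', h1, t', h2, m, h3, hs⟩
    · exact absurd hm (Set.notMem_empty _)
  delivery id _ q hq t' t m hm ht ha := by
    -- Delivery is only due from GST on, when everything sent so far arrives; `0 < Δ` makes the
    -- arrival strictly later than the sending.
    have hT : ¬ t < T := by omega
    refine ⟨t, le_rfl, by omega, ?_⟩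
    rw [if_pos ⟨ha, fun h => absurd h hT⟩, if_neg hT]
    exact (mem_runState_snd E).2 ⟨q, hq, t', by omega, hm⟩

/-! ### Logs of correct nodes as logs of permissioned runs -/

theorem permissioned_runExecution (hpick : ∀ s, s.Nonempty → pick s ∈ s) (hΔ : 0 < Δ)
    (hE : QuasiPermissionless σ ρ owner E) {B : Log Id App} (hB : B ∈ E.logs) (T : ℕ) :
    Permissioned σ ρ (runExecution E hpick hΔ B T) := by
  obtain ⟨hg, p, hp, t, ht⟩ := hB
  exact ⟨fun _ _ => Iff.rfl, hE.2 p hp t B hg ht⟩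

theorem baseLog_mem_logs {L : Log Id App} (hL : L ∈ E.logs) : baseLog σ ρ g L ∈ E.logs :=
  E.mem_logs_of_prefix hL (genesis_prefix_baseLog σ ρ hL.1) (baseLog_prefix σ ρ hL.1)

/-- A certified log was obtained in the run of the permissioned protocol from its base. -/
theorem exists_mem_logs_of_certified (hpick : ∀ s, s.Nonempty → pick s ∈ s) (hΔ : 0 < Δ)
    (hρ : ρ < 1 / 2) (hE : QuasiPermissionless σ ρ owner E) {p : Node} (hp : p ∉ E.faulty) {t : ℕ}
    {L : Log Id App} (hL : L ∈ E.logs) (hne : L ≠ g)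
    (hc : Certified σ ρ g (tState E p t).votes L) :
    ∃ T₀, ∀ T ≥ T₀, L ∈ (runExecution E hpick hΔ (baseLog σ ρ g L) T).logs := by
  obtain ⟨hg, hw⟩ := hc.resolve_left hne
  obtain ⟨hgB, q, hq, t₁, hBq⟩ := baseLog_mem_logs (σ := σ) (ρ := ρ) E hL
  obtain ⟨id, ⟨_, hv⟩, hid⟩ := σ.exists_mem_not_mem hρ hw (hE.2 q hq t₁ _ hgB hBq)
  obtain ⟨B, t', hrun, hlog, hBL, he⟩ := exists_running_of_mem_votes E hp hid hv
  have hgl := genesis_prefix_tState_log E hpick hid (t' + 1)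
  have hbase := hrun.base_eq
  rw [tState_base E hid] at hbase
  have hB : baseLog σ ρ g L = B := baseLog_eq_of_completed σ ρ
    (hbase ▸ genesis_prefix_simBase σ ρ hgl) (hbase ▸ completed_simBase σ ρ hgl) hBL he
  rw [hB]
  -- Every cutoff after the signing preserves the signer's state; this freedom later allows one
  -- cutoff for several logs.
  refine ⟨t' + 1, fun T hT => ⟨hBL, id, hid, t' + 1, ?_⟩⟩
  have := (runState_eq E hpick hid hrun.mem_currentIds hT).1 hrun.base_eq
  change L <+: P.log ((runState E B T (t' + 1)).1 id)
  rwa [this]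

/-- Every log of the transformed protocol is a log of the run of the permissioned protocol from
its base. -/
theorem exists_mem_logs (hpick : ∀ s, s.Nonempty → pick s ∈ s) (hΔ : 0 < Δ)
    (hρ : ρ < 1 / 2) (hE : QuasiPermissionless σ ρ owner E)
    {L : Log Id App} (hL : L ∈ E.logs) (hne : L ≠ g) :
    ∃ T₀, ∀ T ≥ T₀, L ∈ (runExecution E hpick hΔ (baseLog σ ρ g L) T).logs := by
  obtain ⟨hg, p, hp, t, ht⟩ := hL
  change L <+: (tState E p t).log at ht
  have hlog : (tState E p t).log ∈ E.logs := ⟨hg.trans ht, p, hp, t, List.prefix_refl _⟩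
  have hne' : ∀ M, L <+: M → M ≠ g := by
    rintro M hM rfl
    exact hne (hM.eq_of_length_le hg.length_le)
  -- It suffices to find a certified extension of `L` in the same epoch, as it has the same base.
  have key : ∀ M, L <+: M → M <+: (tState E p t).log → epoch σ ρ g M = epoch σ ρ g L →
      (∃ t', Certified σ ρ g (tState E p t').votes M) →
      ∃ T₀, ∀ T ≥ T₀, L ∈ (runExecution E hpick hΔ (baseLog σ ρ g L) T).logs := by
    rintro M hLM hM he ⟨t', hc⟩
    obtain ⟨T₀, hT₀⟩ := exists_mem_logs_of_certified E hpick hΔ hρ hE hp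
      (E.mem_logs_of_prefix hlog (hg.trans hLM) hM) (hne' M hLM) hc
    rw [baseLog_eq_of_epoch_eq σ ρ hg hne hLM he] at hT₀
    exact ⟨T₀, fun T hT => (runExecution E hpick hΔ _ T).mem_logs_of_prefix (hT₀ T hT)
      (baseLog_prefix σ ρ hg) hLM⟩
  obtain ⟨t', hc, hfc⟩ := (tState_log_certified E hpick hp t).resolve_left (hne' _ ht)
  rcases (epoch_mono σ ρ hg ht).eq_or_lt with he | hlt
  · exact key _ ht (List.prefix_refl _) he.symm ⟨t', hc⟩
  -- The node's log is already in a later epoch, so its certificate says nothing about the run of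
  -- `L`. The log that ended the epoch of `L` is certified as well, by full certification.
  · obtain ⟨M, h1, h2, h3, h4⟩ := exists_completed_of_epoch_lt σ ρ hg ht hlt
    exact key M h1 h2 h4 ⟨t', hfc M (hg.trans h1) h2 h3 (h4 ▸ hlt)⟩

end Simulation

/-- Without rollbacks, logs held at different times can both be extended to the later time and
compared there. -/
theorem Execution.Consistent.logConsistent {Node T : Type*} {M : Protocol Node T} {Δ : ℕ}
    {g : List T} {E : Execution M Δ g} (h : E.Consistent) {L L' : List T} (hL : L ∈ E.logs)
    (hL' : L' ∈ E.logs) : LogConsistent L L' := by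
  obtain ⟨_, p, hp, t, ht⟩ := hL
  obtain ⟨_, q, hq, t', ht'⟩ := hL'
  exact (h.2 p hp q hq (max t t')).of_prefix (ht.trans (h.1 p hp _ _ (le_max_left _ _)))
    (ht'.trans (h.1 q hq _ _ (le_max_right _ _)))

/-! ### Consistency and composition over the epochs -/

section Main

variable {Id App Node : Type*} {P : Protocol Id (Tx Id App)} {σ : Stake Id App} {ρ : ℝ}
  {Δ ell : ℕ} {pick : Set (Log Id App) → Log Id App} {owner : Id → Node} {g : Log Id App}
  {E : Execution (transform P σ ρ Δ ell pick owner) Δ g}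

/-- The logs of the transformed protocol are pairwise consistent. -/
theorem logConsistent_of_mem_logs (hρ : ρ < 1 / 2) (hΔ : 0 < Δ)
    (hP : ∀ (g : Log Id App) (E : Execution P Δ g), Permissioned σ ρ E → E.Consistent)
    (hpick : ∀ s, s.Nonempty → pick s ∈ s) (hE : QuasiPermissionless σ ρ owner E)
    {L L' : Log Id App} (hL : L ∈ E.logs) (hL' : L' ∈ E.logs) : LogConsistent L L' := by
  -- By symmetry `L` has the larger epoch, and passing to its base lowers that epoch by one.
  suffices h : ∀ n, ∀ L ∈ E.logs, ∀ L' ∈ E.logs, epoch σ ρ g L = n → epoch σ ρ g L' ≤ n →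
      LogConsistent L L' by
    rcases le_total (epoch σ ρ g L) (epoch σ ρ g L') with hle | hle
    · exact (h _ L' hL' L hL rfl hle).symm
    · exact h _ L hL L' hL' rfl hle
  intro n
  induction n using Nat.strong_induction_on with
  | _ n ih =>
  intro L hL L' hL' hn hn'
  by_cases hne : L = g
  · exact Or.inl (hne ▸ hL'.1)
  have hB := baseLog_mem_logs (σ := σ) (ρ := ρ) E hL
  have heB := epoch_eq_epoch_baseLog_add_one σ ρ hL.1 hne
  have hBL := baseLog_prefix σ ρ hL.1
  have hBc := completed_baseLog σ ρ hL.1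
  rcases hn'.lt_or_eq with hlt | heq
  · rcases ih _ (by omega) _ hB L' hL' rfl (by omega) with h | h
    · rcases eq_or_ne (baseLog σ ρ g L) L' with h' | h'
      · exact Or.inr (h' ▸ hBL)
      -- A strict extension of the completed base would have epoch at least `n`.
      · have := epoch_lt_of_completed σ ρ hB.1 hBc h h'
        omega
    · exact Or.inr (h.trans hBL)
  · have hne' : L' ≠ g := by
      rintro rfl
      rw [epoch_genesis] at heq
      omega
    have hB' := baseLog_mem_logs (σ := σ) (ρ := ρ) E hL'
    have heB' := epoch_eq_epoch_baseLog_add_one σ ρ hL'.1 hne'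
    have hBB : baseLog σ ρ g L = baseLog σ ρ g L' :=
      eq_of_completed_of_epoch_eq σ ρ hB.1 hB'.1 hBc (completed_baseLog σ ρ hL'.1) (by omega)
        (ih _ (by omega) _ hB _ hB' rfl (by omega))
    obtain ⟨T, hT⟩ := exists_mem_logs E hpick hΔ hρ hE hL hne
    obtain ⟨T', hT'⟩ := exists_mem_logs E hpick hΔ hρ hE hL' hne'
    rw [← hBB] at hT'
    exact (hP _ _ (permissioned_runExecution E hpick hΔ hE hB (max T T'))).logConsistent
      (hT _ (le_max_left _ _)) (hT' _ (le_max_right _ _))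

/-- The logs of one epoch inherit a safety property from the permissioned protocol. -/
theorem satisfies_logs_of_baseLog_eq (hρ : ρ < 1 / 2) (hΔ : 0 < Δ)
    {Q : Set (Log Id App) → Prop} (hsafe : IsSafety Q)
    (hPQ : Satisfies P Δ (fun _ E => Permissioned σ ρ E) Q)
    (hpick : ∀ s, s.Nonempty → pick s ∈ s) (hE : QuasiPermissionless σ ρ owner E)
    {B : Log Id App} (hB : B ∈ E.logs) (hQB : Q {B}) :
    Q {L | L ∈ E.logs ∧ L ≠ g ∧ baseLog σ ρ g L = B} := by
  by_contra hQ
  obtain ⟨F, hF, hfin, hQF⟩ := hsafe.2 _ hQ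
  -- Each log of `F` occurs for all large cutoffs; as `F` is finite, one cutoff serves all of them.
  have hT : ∀ᶠ T in Filter.atTop, ∀ L ∈ F, L ∈ (runExecution E hpick hΔ B T).logs := by
    rw [Filter.eventually_all_finite hfin]
    intro L hL
    obtain ⟨h1, h2, rfl⟩ := hF hL
    exact Filter.eventually_atTop.2 (exists_mem_logs E hpick hΔ hρ hE h1 h2)
  obtain ⟨T, hT⟩ := hT.exists
  exact hQF (hsafe.1 _ _ hT
    (hPQ B _ (permissioned_runExecution E hpick hΔ hE hB T) hQB))

/-- All logs of epoch `n + 1` share one base `B`, which separates them from the logs of epoch at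
most `n`; composability is applied at this `B`. -/
theorem satisfies_logs_of_epoch_le (hρ : ρ < 1 / 2) (hΔ : 0 < Δ)
    (hP : ∀ (g : Log Id App) (E : Execution P Δ g), Permissioned σ ρ E → E.Consistent)
    {Q : Set (Log Id App) → Prop} (hsafe : IsSafety Q) (hcomp : IsComposable Q)
    (hPQ : Satisfies P Δ (fun _ E => Permissioned σ ρ E) Q)
    (hpick : ∀ s, s.Nonempty → pick s ∈ s) (hE : QuasiPermissionless σ ρ owner E)
    (hQg : Q {g}) (n : ℕ) : Q {L | L ∈ E.logs ∧ epoch σ ρ g L ≤ n} := by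
  induction n with
  | zero =>
    refine hsafe.1 _ _ ?_ hQg
    rintro L ⟨hL, he⟩
    exact eq_genesis_of_epoch_eq_zero σ ρ hL.1 (by omega)
  | succ n ih =>
    by_cases hex : ∃ L ∈ E.logs, epoch σ ρ g L = n + 1
    · obtain ⟨L₀, hL₀, he₀⟩ := hex
      have hcons {L L'} (h : L ∈ E.logs) (h' : L' ∈ E.logs) : LogConsistent L L' :=
        logConsistent_of_mem_logs hρ hΔ hP hpick hE h h'
      have hne {L} (he : epoch σ ρ g L = n + 1) : L ≠ g := by
        rintro rfl
        rw [epoch_genesis] at he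
        omega
      have hB := baseLog_mem_logs (σ := σ) (ρ := ρ) E hL₀
      have hBe := epoch_eq_epoch_baseLog_add_one σ ρ hL₀.1 (hne he₀)
      have hBc := completed_baseLog σ ρ hL₀.1
      set B := baseLog σ ρ g L₀
      have hext {L} (hL : L ∈ E.logs) (he : epoch σ ρ g L = n + 1) : baseLog σ ρ g L = B := by
        have hL' := epoch_eq_epoch_baseLog_add_one σ ρ hL.1 (hne he)
        have hBL := baseLog_mem_logs (σ := σ) (ρ := ρ) E hL
        exact eq_of_completed_of_epoch_eq σ ρ hBL.1 hB.1 (completed_baseLog σ ρ hL.1) hBc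
          (by omega) (hcons hBL hB)
      have hQB : Q {L | L ∈ E.logs ∧ L ≠ g ∧ baseLog σ ρ g L = B} := by
        -- As `B` has epoch `n`, the induction hypothesis yields `Q {B}`, the condition on genesis
        -- logs under which `P` guarantees `Q`.
        refine satisfies_logs_of_baseLog_eq hρ hΔ hsafe hPQ hpick hE hB (hsafe.1 _ _ ?_ ih)
        rintro L rfl
        exact ⟨hB, by omega⟩
      refine hcomp B {L | L ∈ E.logs ∧ epoch σ ρ g L ≤ n}
        {L | L ∈ E.logs ∧ L ≠ g ∧ baseLog σ ρ g L = B} ?_ ?_ (fun L h L' h' => hcons h.1 h'.1)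
        (fun A hA => hsafe.1 _ _ hA ih) (fun A hA => hsafe.1 _ _ hA hQB) _ ?_
      · rintro L ⟨hL, he⟩
        rcases hcons hL hB with h | h
        · exact h
        · by_contra hLB
          -- A log strictly beyond the completed `B` has epoch above `n`.
          have := epoch_lt_of_completed σ ρ hB.1 hBc h
            fun e => hLB (e ▸ List.prefix_refl _)
          omega
      · rintro L ⟨hL, hLg, hLB⟩
        exact ⟨hLB ▸ baseLog_prefix σ ρ hL.1, fun e => baseLog_ne σ ρ hL.1 hLg (hLB.trans e.symm)⟩
      · rintro L ⟨hL, he⟩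
        rcases he.lt_or_eq with hlt | heq
        · exact Or.inl ⟨hL, by omega⟩
        · exact Or.inr ⟨hL, hne heq, hext hL heq⟩
    · refine hsafe.1 _ _ ?_ ih
      rintro L ⟨hL, he⟩
      refine ⟨hL, ?_⟩
      by_contra h
      exact hex ⟨L, hL, by omega⟩

end Main

theorem mainTheorem3 {Id App Node : Type*}
    (σ : Stake Id App) (ρ : ℝ) (hρ0 : 0 ≤ ρ) (hρ : ρ < 1 / 2) (Δ : ℕ) (hΔ : 0 < Δ)
    (P : Protocol Id (Tx Id App))
    (hP : ∀ (g : Log Id App) (E : Execution P Δ g), Permissioned σ ρ E → E.Consistent)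
    (Q : Set (Log Id App) → Prop) (hsafe : IsSafety Q) (hcomp : IsComposable Q)
    (hPQ : Satisfies P Δ (fun _ E => Permissioned σ ρ E) Q)
    (ell : ℕ) (pick : Set (Log Id App) → Log Id App) (hpick : ∀ s, s.Nonempty → pick s ∈ s)
    (owner : Id → Node) :
    Satisfies (transform P σ ρ Δ ell pick owner) Δ
      (fun _ E => QuasiPermissionless σ ρ owner E) Q := by
  intro g E hE hQg
  by_contra hQ
  obtain ⟨F, hF, hfin, hQF⟩ := hsafe.2 _ hQ
  -- An execution may go through infinitely many epochs, but a finite violation meets only boundedly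
  -- many.
  obtain ⟨n, hn⟩ := (hfin.image (epoch σ ρ g)).bddAbove
  have hsub : F ⊆ {L | L ∈ E.logs ∧ epoch σ ρ g L ≤ n} :=
    fun L hL => ⟨hF hL, hn (Set.mem_image_of_mem _ hL)⟩
  exact hQF (hsafe.1 _ _ hsub
    (satisfies_logs_of_epoch_le hρ hΔ hP hsafe hcomp hPQ hpick hE hQg n))
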